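/- Let $D\subset\mathbb R^2$ be the open unit disk, let $(\varphi_n)_{n}$ be an orthonormal basis of the real space $L^2(D)$ made of eigenfunctions of the Dirichlet Laplacian ($\varphi_n\in H^1_0(D)$, $-\Delta\varphi_n=\lambda_n\varphi_n$ weakly), with eigenvalues $\lambda_1\le\lambda_2\le\cdots$, and put $c_n=\int_D\varphi_n$. Let $Y=(0,1)^2$, $0<\delta<1/2$, and $$M=\{(\theta,\rho,\varepsilon)\in Y\times[0,1/2]\times\mathbb C:\ \operatorname{Im}\varepsilon\ge 0,\ \mathrm{dist}(\theta,\partial Y)\ge\rho+\delta\}.$$ Let $\theta_0\in\mathbb R^2$ and $\rho^+>0$ satisfy $\overline{B(\theta_0,\rho^+)}\subset Y$ and $\rho^++\delta\le\mathrm{dist}(\theta_0,\partial Y)$, let $\gamma$ be a Borel probability measure on $(0,\rho^+]$, and let $g:\mathbb R\to[0,\infty)$ be a Lipschitz function with compact support and $\int g=1$. For $h\ge0$ consider the law, with $\varepsilon=a+ib$, $$p_h=\delta_0(\theta-\theta_0)\otimes\gamma(\rho)\otimes g(a)\,da\otimes\delta_0(b-h),$$ and for $k_0>0$, $h>0$ set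 $$\mu^{\rm eff}_h(k_0)=1+\sum_n c_n^2\int_M\frac{\varepsilon k_0^2\rho^4}{\lambda_n-\varepsilon k_0^2\rho^2}\,dp_h(\theta,\rho,\varepsilon),\qquad f_n(s)=\frac{\lambda_n}{k_0^2}\int_{(0,\rho^+]}g\Big(\frac{\lambda_n}{k_0^2\rho^2}+s\Big)\,\gamma(d\rho).$$ Then for every $k_0>0$ the integrals and the series defining $\mu_h^{\rm eff}(k_0)$ converge absolutely for every $h>0$, each principal value $\mathrm{PV}\int \frac{f_n(s)}{s}\,ds=\lim_{r\to0^+}\int_{\mathbb R\setminus[-r,r]}\frac{f_n(s)}{s}\,ds$ exists, the series below converges absolutely, and as $h\to0^+$ $$\mu^{\rm eff}_h(k_0)\ \longrightarrow\ \mu^{\rm eff}_0(k_0):=1-\pi\int_{(0,\rho^+]}\rho^2\,\gamma(d\rho)+\sum_n c_n^2\Big(-\mathrm{PV}\!\int\frac{f_n(s)}{s}\,ds+i\pi f_n(0)\Big).$$ Moreover $\operatorname{Im}\mu^{\rm eff}_0(k_0)\ge0$ for every $k_0>0$. Although the law $p_0$ is non-dissipative, that is $p_0(\operatorname{Im}\varepsilon>0)=0$,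 if $g(a)>0$ for some $a>0$ then there is a nonempty open interval of wave numbers $k_0>0$ on which $\operatorname{Im}\mu^{\rm eff}_0(k_0)>0$. -/

import Mathlib

open Set Filter Topology MeasureTheory
open scoped ContDiff

namespace RandomRods

noncomputable section

/-- The Euclidean plane. -/
abbrev Plane : Type := EuclideanSpace ℝ (Fin 2)

/-! ### The Dirichlet Laplacian on the unit disk -/

/-- The open unit disk `D = B(0,1)`. -/
def unitDisk : Set Plane := Metric.ball 0 1

/-- Lebesgue measure on the unit disk. -/
def diskMeasure : Measure Plane := volume.restrict unitDisk

/-- Real test functions, `ψ ∈ C_c^∞(D)`. -/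
def IsDiskTest (ψ : Plane → ℝ) : Prop :=
  ContDiff ℝ ∞ ψ ∧ HasCompactSupport ψ ∧ tsupport ψ ⊆ unitDisk

/-- `u ∈ H¹₀(D)` (the closure of `C_c^∞(D)` in `H¹(D)`) and `∇u = G`: there are test functions
`ψ k` with `ψ k → u` and `∇(ψ k) → G` in `L²(D)`. -/
def HasDirichletGradient (u : Plane → ℝ) (G : Plane → Plane) : Prop :=
  MemLp u 2 diskMeasure ∧ MemLp G 2 diskMeasure ∧
    ∃ ψ : ℕ → Plane → ℝ, (∀ k, IsDiskTest (ψ k)) ∧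
      Tendsto (fun k => eLpNorm (fun x => ψ k x - u x) 2 diskMeasure) atTop (𝓝 0) ∧
      Tendsto (fun k => eLpNorm (fun x => gradient (ψ k) x - G x) 2 diskMeasure) atTop (𝓝 0)

/-- `u` is a weak solution of `-Δu = lam u` in `D`, `u = 0` on `∂D`. -/
def IsDirichletEigenfunction (lam : ℝ) (u : Plane → ℝ) : Prop :=
  ∃ G : Plane → Plane, HasDirichletGradient u G ∧
    ∀ ψ : Plane → ℝ, IsDiskTest ψ →
      ∫ x, inner ℝ (G x) (gradient ψ x) ∂diskMeasure = lam * ∫ x, u x * ψ x ∂diskMeasure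

/-- `φ` is an orthonormal basis of `L²(D)` made of eigenfunctions of the Dirichlet Laplacian,
and `lam` is the nondecreasing sequence of the corresponding eigenvalues (counted with
multiplicity, the index starting at `0`). -/
def IsDirichletEigenbasis (lam : ℕ → ℝ) (φ : HilbertBasis ℕ ℝ (Lp ℝ 2 diskMeasure)) : Prop :=
  Monotone lam ∧ ∀ n, IsDirichletEigenfunction (lam n) (φ n : Plane → ℝ)

/-- `c_n = ∫_D φ_n`. -/
def eigenMean (φ : HilbertBasis ℕ ℝ (Lp ℝ 2 diskMeasure)) (n : ℕ) : ℝ :=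
  ∫ x, (φ n : Plane → ℝ) x ∂diskMeasure

/-! ### The laws of the random rods -/

/-- The unit cell `Y = (0,1)²`. -/
def unitCell : Set Plane := {x | ∀ i, x i ∈ Ioo (0 : ℝ) 1}

/-- The set `M` of admissible triples (centre, radius, permittivity) `(θ, ρ, ε)`. -/
def rodSpace (δ : ℝ) : Set (Plane × ℝ × ℂ) :=
  {m | m.1 ∈ unitCell ∧ m.2.1 ∈ Icc (0 : ℝ) (1 / 2) ∧ 0 ≤ m.2.2.im ∧
    m.2.1 + δ ≤ Metric.infDist m.1 (frontier unitCell)}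

/-- The law `p_h = δ₀(θ - θ₀) ⊗ γ(ρ) ⊗ g(a) da ⊗ δ₀(b - h)`, where `ε = a + i b`. -/
def rodLaw (θ₀ : Plane) (γ : Measure ℝ) (g : ℝ → ℝ) (h : ℝ) : Measure (Plane × ℝ × ℂ) :=
  (Measure.dirac θ₀).prod (γ.prod
    (((volume.withDensity fun a => ENNReal.ofReal (g a)).prod (Measure.dirac h)).map
      Complex.measurableEquivRealProd.symm))

/-- The integrand `ε k₀² ρ⁴ / (lam - ε k₀² ρ²)` of the effective permeability. -/
def resonantRatio (k₀ lam : ℝ) (m : Plane × ℝ × ℂ) : ℂ :=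
  m.2.2 * (k₀ : ℂ) ^ 2 * (m.2.1 : ℂ) ^ 4 / ((lam : ℂ) - m.2.2 * (k₀ : ℂ) ^ 2 * (m.2.1 : ℂ) ^ 2)

/-- The `n`-th term `c_n² ∫_M ε k₀² ρ⁴ / (lam_n - ε k₀² ρ²) dp` of the effective permeability
of a law `p`. -/
def permeabilityTerm (lam : ℕ → ℝ) (φ : HilbertBasis ℕ ℝ (Lp ℝ 2 diskMeasure)) (δ : ℝ)
    (p : Measure (Plane × ℝ × ℂ)) (k₀ : ℝ) (n : ℕ) : ℂ :=
  (eigenMean φ n : ℂ) ^ 2 * ∫ m in rodSpace δ, resonantRatio k₀ (lam n) m ∂p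

/-- The effective permeability `μ^eff(k₀)` associated with a law `p` on `M`. -/
def effPermeability (lam : ℕ → ℝ) (φ : HilbertBasis ℕ ℝ (Lp ℝ 2 diskMeasure)) (δ : ℝ)
    (p : Measure (Plane × ℝ × ℂ)) (k₀ : ℝ) : ℂ :=
  1 + ∑' n, permeabilityTerm lam φ δ p k₀ n

/-! ### The limit -/

/-- The principal value `PV ∫ F` exists and is equal to `l`. -/
def HasPrincipalValue (F : ℝ → ℝ) (l : ℝ) : Prop :=
  (∀ r > 0, IntegrableOn F (Icc (-r) r)ᶜ) ∧
    Tendsto (fun r : ℝ => ∫ t in (Icc (-r) r)ᶜ, F t) (𝓝[>] 0) (𝓝 l)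

/-- `PV ∫ F = lim_{r → 0+} ∫_{ℝ \ [-r, r]} F` (meaningful when `HasPrincipalValue F l` for
some `l`, and then equal to `l`). -/
def principalValue (F : ℝ → ℝ) : ℝ :=
  limUnder (𝓝[>] (0 : ℝ)) fun r : ℝ => ∫ t in (Icc (-r) r)ᶜ, F t

/-- `f(s) = (lam / k₀²) ∫_{(0, ρmax]} g(lam / (k₀² ρ²) + s) γ(dρ)`; for `lam = lam_n` this is
the function `f_n`. -/
def shiftedDensity (γ : Measure ℝ) (ρmax : ℝ) (g : ℝ → ℝ) (k₀ lam : ℝ) (s : ℝ) : ℝ :=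
  lam / k₀ ^ 2 * ∫ ρ in Ioc 0 ρmax, g (lam / (k₀ ^ 2 * ρ ^ 2) + s) ∂γ

/-- The `n`-th term `c_n² (-PV ∫ f_n(s)/s ds + i π f_n(0))` of the limit permeability. -/
def limitTerm (lam : ℕ → ℝ) (φ : HilbertBasis ℕ ℝ (Lp ℝ 2 diskMeasure)) (γ : Measure ℝ)
    (ρmax : ℝ) (g : ℝ → ℝ) (k₀ : ℝ) (n : ℕ) : ℂ :=
  (eigenMean φ n : ℂ) ^ 2 *
    (-(principalValue fun s => shiftedDensity γ ρmax g k₀ (lam n) s / s : ℂ) +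
      Complex.I * (Real.pi : ℂ) * (shiftedDensity γ ρmax g k₀ (lam n) 0 : ℂ))

/-- The limit permeability
`μ₀^eff(k₀) = 1 - π ∫ ρ² dγ + ∑ c_n² (-PV ∫ f_n(s)/s ds + i π f_n(0))`. -/
def limitPermeability (lam : ℕ → ℝ) (φ : HilbertBasis ℕ ℝ (Lp ℝ 2 diskMeasure))
    (γ : Measure ℝ) (ρmax : ℝ) (g : ℝ → ℝ) (k₀ : ℝ) : ℂ :=
  1 - (Real.pi : ℂ) * ((∫ ρ in Ioc 0 ρmax, ρ ^ 2 ∂γ : ℝ) : ℂ) +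
    ∑' n, limitTerm lam φ γ ρmax g k₀ n

end

end RandomRods

namespace RandomRods

/-! The limit is the Sokhotski–Plemelj formula applied term by term. With `X = lam / (k₀² ρ²)` the
resonant ratio is `ρ² ε / (X - ε) = -ρ² - (lam / k₀²) / (ε - X)`. Averaging over `a = X + s` and
over `ρ` turns the `n`-th integral into `-∫ ρ² dγ - ∫ f_n(s) / (s + i h) ds`
(`integral_sq_mul_cauchyAverage`). Since `f_n` is Lipschitz and integrable, the last integral tends
to `PV ∫ f_n(s) / s ds - i π f_n(0)` (`tendsto_integral_div_add_mul_I`, `hasPrincipalValue_div`).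

Limit and series may be exchanged because the averaged ratio is bounded uniformly in `X ≥ 0` and
small `h` (`exists_cauchyAverage_bound`), while `∑ c_n² = π` by Parseval (`hasSum_sq_eigenMean`).
The same identity produces the term `-π ∫ ρ² dγ`.

Principal values are real, so the imaginary part of the limit is `π ∑ c_n² f_n(0)`. It is
nonnegative because the eigenvalues are positive (Poincaré inequality). It is positive as soon as
some `n` with `c_n ≠ 0` resonates: `lam_n / (k₀² ρ²)` hits a point where `g > 0` for some `ρ` in the
support of `γ`. -/

/-! ### The Sokhotski–Plemelj formula for Lipschitz integrable functions. -/

/-- `F` minus its value at `0` on `[-1, 1]`. -/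
noncomputable def centered (F : ℝ → ℝ) (s : ℝ) : ℝ :=
  F s - (Icc (-1 : ℝ) 1).indicator (fun _ => F 0) s

/-- An integrable bound of `centered F s / s`. -/
noncomputable def centeredBound (K : NNReal) (F : ℝ → ℝ) (s : ℝ) : ℝ :=
  (Icc (-1 : ℝ) 1).indicator (fun _ => (K : ℝ)) s + |F s|

theorem integrable_indicator_Icc_const {E : Type*} [NormedAddCommGroup E] (c : E) :
    Integrable ((Icc (-1 : ℝ) 1).indicator fun _ => c) :=
  (integrable_indicator_iff measurableSet_Icc).2 (by simp)

theorem integrable_centeredBound {F : ℝ → ℝ} (K : NNReal) (hF : Integrable F) :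
    Integrable (centeredBound K F) :=
  (integrable_indicator_Icc_const _).add hF.abs

theorem integral_centeredBound {F : ℝ → ℝ} (K : NNReal) (hF : Integrable F) :
    ∫ s, centeredBound K F s = 2 * K + ∫ s, |F s| := by
  unfold centeredBound
  rw [integral_add (integrable_indicator_Icc_const _) hF.abs, integral_indicator measurableSet_Icc]
  norm_num

theorem centeredBound_nonneg (K : NNReal) (F : ℝ → ℝ) (s : ℝ) : 0 ≤ centeredBound K F s :=
  add_nonneg (indicator_nonneg (fun _ _ => K.2) _) (abs_nonneg _)

/-- On `[-1, 1]` this is the Lipschitz condition at `0`; outside, `1 ≤ |s|`. It removes the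
singularity of `1 / s`, and of `1 / (s + i h)` uniformly in `h`. -/
theorem abs_centered_le {F : ℝ → ℝ} {K : NNReal} (hL : LipschitzWith K F) (s : ℝ) :
    |centered F s| ≤ centeredBound K F s * |s| := by
  unfold centered centeredBound
  by_cases hs : s ∈ Icc (-1 : ℝ) 1
  · have h := hL.dist_le_mul s 0
    rw [Real.dist_eq, Real.dist_eq, sub_zero] at h
    rw [indicator_of_mem hs, indicator_of_mem hs]
    nlinarith [abs_nonneg (F s), abs_nonneg s]
  · have h1 : 1 ≤ |s| := by
      by_contra! h
      exact hs (abs_le.1 h.le)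
    rw [indicator_of_notMem hs, indicator_of_notMem hs]
    simp only [sub_zero, zero_add]
    nlinarith [abs_nonneg (F s)]

theorem integrable_centered {F : ℝ → ℝ} (hF : Integrable F) : Integrable (centered F) :=
  hF.sub (integrable_indicator_Icc_const _)

theorem integrable_centered_div {F : ℝ → ℝ} {K : NNReal} (hL : LipschitzWith K F)
    (hF : Integrable F) : Integrable fun s => centered F s / s := by
  refine (integrable_centeredBound K hF).mono'
    ((integrable_centered hF).aestronglyMeasurable.div₀
      continuous_id.aestronglyMeasurable) (ae_of_all _ fun s => ?_)
  rw [Real.norm_eq_abs, abs_div]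
  exact div_le_of_le_mul₀ (abs_nonneg _) (centeredBound_nonneg K F s) (abs_centered_le hL s)

theorem abs_le_norm_add_mul_I (s h : ℝ) : |s| ≤ ‖(s : ℂ) + h * Complex.I‖ := by
  simpa using Complex.abs_re_le_norm ((s : ℂ) + h * Complex.I)

theorem le_norm_add_mul_I (s h : ℝ) : |h| ≤ ‖(s : ℂ) + h * Complex.I‖ := by
  simpa using Complex.abs_im_le_norm ((s : ℂ) + h * Complex.I)

theorem add_mul_I_ne_zero (s : ℝ) {h : ℝ} (hh : 0 < h) : (s : ℂ) + h * Complex.I ≠ 0 := by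
  intro h0
  simpa [hh.ne'] using congrArg Complex.im h0

theorem continuous_inv_add_mul_I {h : ℝ} (hh : 0 < h) :
    Continuous fun s : ℝ => ((s : ℂ) + h * Complex.I)⁻¹ :=
  Continuous.inv₀ (by fun_prop) fun s => add_mul_I_ne_zero s hh

theorem integrable_div_add_mul_I {F : ℝ → ℝ} (hF : Integrable F) {h : ℝ} (hh : 0 < h) :
    Integrable fun s => (F s : ℂ) / ((s : ℂ) + h * Complex.I) := by
  simp_rw [div_eq_mul_inv]
  refine hF.ofReal.mul_bdd (c := h⁻¹) (continuous_inv_add_mul_I hh).aestronglyMeasurable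
    (ae_of_all _ fun s => ?_)
  rw [norm_inv]
  exact inv_anti₀ hh ((le_abs_self h).trans (le_norm_add_mul_I s h))

theorem norm_centered_div_le {F : ℝ → ℝ} {K : NNReal} (hL : LipschitzWith K F) (h s : ℝ) :
    ‖(centered F s : ℂ) / ((s : ℂ) + h * Complex.I)‖ ≤ centeredBound K F s := by
  rw [norm_div, Complex.norm_real, Real.norm_eq_abs]
  refine div_le_of_le_mul₀ (norm_nonneg _) (centeredBound_nonneg K F s)
    ((abs_centered_le hL s).trans ?_)
  exact mul_le_mul_of_nonneg_left (abs_le_norm_add_mul_I s h) (centeredBound_nonneg K F s)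

/-- The primitive `log(s² + h²) / 2 - i arctan(s / h)` has an even real part, which cancels between
`-1` and `1`. The real arctangent avoids choosing a branch of the complex logarithm. -/
theorem integral_Icc_inv_add_mul_I {h : ℝ} (hh : 0 < h) :
    ∫ s in Icc (-1 : ℝ) 1, ((s : ℂ) + h * Complex.I)⁻¹ =
      -(2 * Real.arctan h⁻¹ : ℝ) * Complex.I := by
  rw [integral_Icc_eq_integral_Ioc, ← intervalIntegral.integral_of_le (by norm_num)]
  have hd : ∀ s ∈ uIcc (-1 : ℝ) 1, HasDerivAt
      (fun s : ℝ => ((1 / 2 * Real.log (s ^ 2 + h ^ 2) : ℝ) : ℂ) -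
        (Real.arctan (s * h⁻¹) : ℝ) * Complex.I) ((s : ℂ) + h * Complex.I)⁻¹ s := by
    intro s _
    have hp : 0 < s ^ 2 + h ^ 2 := by positivity
    have h1 : HasDerivAt (fun s : ℝ => 1 / 2 * Real.log (s ^ 2 + h ^ 2)) (s / (s ^ 2 + h ^ 2)) s :=
      ((((hasDerivAt_pow 2 s).add_const (h ^ 2)).log hp.ne').const_mul (1 / 2)).congr_deriv
        (by push_cast; ring)
    have h2 : HasDerivAt (fun s : ℝ => Real.arctan (s * h⁻¹)) (h / (s ^ 2 + h ^ 2)) s :=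
      ((hasDerivAt_id s).mul_const h⁻¹).arctan.congr_deriv
        (by simp only [id]; field_simp; ring)
    refine (h1.ofReal_comp.sub (h2.ofReal_comp.mul_const Complex.I)).congr_deriv ?_
    have hc : ((s : ℂ) ^ 2 + (h : ℂ) ^ 2) ≠ 0 := by exact_mod_cast hp.ne'
    have := add_mul_I_ne_zero s hh
    push_cast
    field_simp
    linear_combination (-(h : ℂ) ^ 2) * Complex.I_sq
  rw [intervalIntegral.integral_eq_sub_of_hasDerivAt hd
    ((continuous_inv_add_mul_I hh).intervalIntegrable _ _)]
  simp [Real.arctan_neg]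
  ring

/-- The value `F 0` carries the whole singular part, which is explicit; the centered part is
dominated uniformly in `h` when `F` is Lipschitz. -/
theorem integral_div_add_mul_I {F : ℝ → ℝ} (hF : Integrable F) {h : ℝ} (hh : 0 < h) :
    ∫ s, (F s : ℂ) / ((s : ℂ) + h * Complex.I) =
      (∫ s, (centered F s : ℂ) / ((s : ℂ) + h * Complex.I)) -
        F 0 * (2 * Real.arctan h⁻¹ : ℝ) * Complex.I := by
  have hsplit : ∀ s, (F s : ℂ) / ((s : ℂ) + h * Complex.I) =
      (centered F s : ℂ) / ((s : ℂ) + h * Complex.I) +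
      (F 0 : ℂ) * (Icc (-1 : ℝ) 1).indicator (fun s => ((s : ℂ) + h * Complex.I)⁻¹) s := by
    intro s
    unfold centered
    by_cases hs : s ∈ Icc (-1 : ℝ) 1
    · rw [indicator_of_mem hs, indicator_of_mem hs]
      push_cast
      ring
    · rw [indicator_of_notMem hs, indicator_of_notMem hs]
      simp
  simp_rw [hsplit]
  rw [integral_add (integrable_div_add_mul_I (integrable_centered hF) hh)
    (((integrable_indicator_iff measurableSet_Icc).2
      ((continuous_inv_add_mul_I hh).integrableOn_Icc)).const_mul _),
    integral_const_mul, integral_indicator measurableSet_Icc, integral_Icc_inv_add_mul_I hh]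
  ring

theorem norm_integral_div_add_mul_I_le {F : ℝ → ℝ} {K : NNReal} (hL : LipschitzWith K F)
    (hF : Integrable F) {h : ℝ} (hh : 0 < h) :
    ‖∫ s, (F s : ℂ) / ((s : ℂ) + h * Complex.I)‖ ≤
      2 * K + (∫ s, |F s|) + |F 0| * Real.pi := by
  rw [integral_div_add_mul_I hF hh]
  refine (norm_sub_le _ _).trans (add_le_add ?_ ?_)
  · rw [← integral_centeredBound K hF]
    exact norm_integral_le_of_norm_le (integrable_centeredBound K hF)
      (ae_of_all _ fun s => norm_centered_div_le hL h s)
  · rw [norm_mul, norm_mul, Complex.norm_I, mul_one, Complex.norm_real, Complex.norm_real,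
      Real.norm_eq_abs, Real.norm_eq_abs]
    refine mul_le_mul_of_nonneg_left ?_ (abs_nonneg _)
    have h1 := Real.arctan_lt_pi_div_two h⁻¹
    have h2 : 0 < Real.arctan h⁻¹ := Real.arctan_pos.2 (inv_pos.2 hh)
    rw [abs_of_pos (by linarith)]
    linarith

theorem tendsto_integral_div_add_mul_I {F : ℝ → ℝ} {K : NNReal} (hL : LipschitzWith K F)
    (hF : Integrable F) :
    Tendsto (fun h : ℝ => ∫ s, (F s : ℂ) / ((s : ℂ) + h * Complex.I)) (𝓝[>] 0)
      (𝓝 (((∫ s, centered F s / s : ℝ) : ℂ) - Complex.I * Real.pi * F 0)) := by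
  have h1 : Tendsto (fun h : ℝ => ∫ s, (centered F s : ℂ) / ((s : ℂ) + h * Complex.I)) (𝓝[>] 0)
      (𝓝 (∫ s, ((centered F s / s : ℝ) : ℂ))) := by
    refine tendsto_integral_filter_of_dominated_convergence (centeredBound K F) ?_ ?_
      (integrable_centeredBound K hF) ?_
    · filter_upwards [self_mem_nhdsWithin] with h hh
      exact (integrable_div_add_mul_I (integrable_centered hF) hh).aestronglyMeasurable
    · exact Eventually.of_forall fun h => ae_of_all _ fun s => norm_centered_div_le hL h s
    · have h0 : ∀ᵐ s : ℝ, s ≠ 0 := by simp [ae_iff]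
      filter_upwards [h0] with s hs
      have hc : ContinuousAt (fun h : ℝ => (centered F s : ℂ) / ((s : ℂ) + h * Complex.I)) 0 :=
        ContinuousAt.div (by fun_prop) (by fun_prop) (by simpa using hs)
      have := hc.tendsto.mono_left (nhdsWithin_le_nhds (s := Ioi 0))
      simpa using this
  rw [integral_complex_ofReal] at h1
  have h2 : Tendsto (fun h : ℝ => ((2 * Real.arctan h⁻¹ : ℝ) : ℂ)) (𝓝[>] 0)
      (𝓝 (Real.pi : ℂ)) := by
    have := ((Real.tendsto_arctan_atTop.mono_right nhdsWithin_le_nhds).comp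
      (tendsto_inv_nhdsGT_zero (𝕜 := ℝ))).const_mul 2
    rw [mul_div_cancel₀ _ (two_ne_zero)] at this
    exact (Complex.continuous_ofReal.tendsto _).comp this
  have h3 := h1.sub ((h2.const_mul (F 0 : ℂ)).mul_const Complex.I)
  have he : ((∫ s, centered F s / s : ℝ) : ℂ) - Complex.I * Real.pi * F 0 =
      ((∫ s, centered F s / s : ℝ) : ℂ) - F 0 * Real.pi * Complex.I := by ring
  rw [he]
  refine h3.congr' ?_
  filter_upwards [self_mem_nhdsWithin] with h hh
  rw [integral_div_add_mul_I hF hh]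

/-! ### Existence of the principal value. -/

theorem integrableOn_div_compl_Icc {F : ℝ → ℝ} (hF : Integrable F) {r : ℝ} (hr : 0 < r) :
    IntegrableOn (fun s => F s / s) (Icc (-r) r)ᶜ := by
  refine (hF.abs.mul_const r⁻¹).integrableOn.mono'
    (hF.aestronglyMeasurable.div₀ continuous_id.aestronglyMeasurable).restrict
    ((ae_restrict_iff' measurableSet_Icc.compl).2 (ae_of_all _ fun s hs => ?_))
  have h1 : r ≤ |s| := by
    by_contra! h
    exact hs (abs_le.1 h.le)
  rw [Real.norm_eq_abs, abs_div, div_eq_mul_inv]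
  exact mul_le_mul_of_nonneg_left (inv_anti₀ hr h1) (abs_nonneg _)

theorem integral_compl_Icc_indicator_div (c r : ℝ) :
    ∫ s in (Icc (-r) r)ᶜ, (Icc (-1 : ℝ) 1).indicator (fun _ => c) s / s = 0 := by
  rw [← integral_indicator measurableSet_Icc.compl]
  set u : ℝ → ℝ := (Icc (-r) r)ᶜ.indicator fun s => (Icc (-1 : ℝ) 1).indicator (fun _ => c) s / s
  have hodd : ∀ s, u (-s) = -u s := by
    intro s
    have h1 : -s ∈ (Icc (-r) r)ᶜ ↔ s ∈ (Icc (-r) r)ᶜ := by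
      simp only [mem_compl_iff, mem_Icc, ← abs_le, abs_neg]
    have h2 : -s ∈ Icc (-1 : ℝ) 1 ↔ s ∈ Icc (-1 : ℝ) 1 := by
      simp only [mem_Icc, ← abs_le, abs_neg]
    simp only [u, indicator_apply, h1, h2]
    split_ifs <;> simp [div_neg]
  have h3 := integral_neg_eq_self u volume
  simp_rw [hodd] at h3
  rw [integral_neg] at h3
  linarith

/-- The constant subtracted on `[-1, 1]` contributes an odd integrand, hence nothing to the
symmetric truncations; what remains is absolutely integrable. -/
theorem hasPrincipalValue_div {F : ℝ → ℝ} {K : NNReal} (hL : LipschitzWith K F)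
    (hF : Integrable F) : HasPrincipalValue (fun s => F s / s) (∫ s, centered F s / s) := by
  refine ⟨fun r hr => integrableOn_div_compl_Icc hF hr, ?_⟩
  have h1 : Tendsto (fun r : ℝ => ∫ s, (Icc (-r) r)ᶜ.indicator (fun s => centered F s / s) s)
      (𝓝[>] 0) (𝓝 (∫ s, centered F s / s)) := by
    refine tendsto_integral_filter_of_dominated_convergence (fun s => |centered F s / s|)
      (Eventually.of_forall fun r => (integrable_centered_div hL hF).aestronglyMeasurable.indicator
        measurableSet_Icc.compl)
      (Eventually.of_forall fun r => ae_of_all _ fun s => ?_)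
      (integrable_centered_div hL hF).abs ?_
    · exact norm_indicator_le_norm_self _ _
    · have h0 : ∀ᵐ s : ℝ, s ≠ 0 := by simp [ae_iff]
      filter_upwards [h0] with s hs
      refine tendsto_const_nhds.congr' ?_
      filter_upwards [nhdsWithin_le_nhds (Iio_mem_nhds (abs_pos.2 hs))] with r hr
      rw [indicator_of_mem]
      intro h
      exact absurd (abs_le.2 h) (not_le.2 hr)
  refine h1.congr' ?_
  filter_upwards [self_mem_nhdsWithin] with r hr
  rw [integral_indicator measurableSet_Icc.compl]
  have h2 : ∀ s, centered F s / s =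
      F s / s - (Icc (-1 : ℝ) 1).indicator (fun _ => F 0) s / s := fun s => sub_div _ _ _
  simp_rw [h2]
  rw [integral_sub (integrableOn_div_compl_Icc hF hr)
    (integrableOn_div_compl_Icc (integrable_indicator_Icc_const _) hr),
    integral_compl_Icc_indicator_div, sub_zero]

theorem HasPrincipalValue.principalValue_eq {F : ℝ → ℝ} {l : ℝ} (h : HasPrincipalValue F l) :
    principalValue F = l :=
  h.2.limUnder_eq

/-! ### Averages over the real permittivity, and their uniform bound. -/

/-- The average of `ε / (X - ε)`, `ε = a + i h`, when `a` has density `g`. -/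
noncomputable def cauchyAverage (g : ℝ → ℝ) (X h : ℝ) : ℂ :=
  ∫ a, (g a : ℂ) * (((a : ℂ) + h * Complex.I) / ((X : ℂ) - ((a : ℂ) + h * Complex.I)))

theorem sub_add_mul_I_ne_zero (X a : ℝ) {h : ℝ} (hh : 0 < h) :
    (X : ℂ) - ((a : ℂ) + h * Complex.I) ≠ 0 := by
  intro h0
  simpa [hh.ne'] using congrArg Complex.im h0

theorem cauchyAverage_eq {g : ℝ → ℝ} (hg1 : ∫ a, g a = 1) (hgi : Integrable g) (X : ℝ) {h : ℝ}
    (hh : 0 < h) : cauchyAverage g X h =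
      -1 - X * ∫ s, (g (X + s) : ℂ) / ((s : ℂ) + h * Complex.I) := by
  have h1 : ∀ a : ℝ,
      (g a : ℂ) * (((a : ℂ) + h * Complex.I) / ((X : ℂ) - ((a : ℂ) + h * Complex.I))) =
      -(g a : ℂ) - X * ((g a : ℂ) / (((a - X : ℝ) : ℂ) + h * Complex.I)) := by
    intro a
    have h2 := sub_add_mul_I_ne_zero X a hh
    have h3 : (((a - X : ℝ) : ℂ) + h * Complex.I) = -((X : ℂ) - ((a : ℂ) + h * Complex.I)) := by
      push_cast
      ring
    rw [h3, div_neg]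
    field_simp
    ring
  have h4 := integrable_div_add_mul_I (hgi.comp_add_left X) hh
  have h5 : Integrable fun a : ℝ => (g a : ℂ) / (((a - X : ℝ) : ℂ) + h * Complex.I) := by
    simpa [neg_add_eq_sub] using h4.comp_add_left (-X)
  have h6 : ∫ a : ℝ, (g a : ℂ) / (((a - X : ℝ) : ℂ) + h * Complex.I) =
      ∫ s, (g (X + s) : ℂ) / ((s : ℂ) + h * Complex.I) := by
    rw [← integral_add_left_eq_self _ X]
    simp
  have h7 : Integrable fun a => -(g a : ℂ) := hgi.ofReal.neg
  unfold cauchyAverage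
  simp_rw [h1]
  rw [integral_sub h7 (h5.const_mul _), integral_neg, integral_const_mul, h6,
    integral_complex_ofReal, hg1, Complex.ofReal_one]

/-- For bounded `X` the Plemelj bound applies; for large `X` the pole is away from the support of
`g` and `|ε / (X - ε)| ≤ 1` there. Uniformity in `X` is uniformity in the eigenvalue and the radius.
-/
theorem exists_cauchyAverage_bound {g : ℝ → ℝ} {K : NNReal} (hg0 : ∀ a, 0 ≤ g a)
    (hg1 : ∫ a, g a = 1) (hgi : Integrable g) (hL : LipschitzWith K g) (hgc : HasCompactSupport g)
    {H : ℝ} (hH : 0 ≤ H) : ∃ C, ∀ X h : ℝ, 0 ≤ X → 0 < h → h ≤ H → ‖cauchyAverage g X h‖ ≤ C := by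
  obtain ⟨S, hS⟩ := hgc.exists_bound_of_continuous hL.continuous
  have hS0 : 0 ≤ S := (norm_nonneg _).trans (hS 0)
  obtain ⟨A, hA0, hA⟩ := hgc.isBounded.exists_pos_norm_le
  have hA' : ∀ a, g a ≠ 0 → |a| ≤ A := fun a ha => hA a (subset_tsupport _ ha)
  refine ⟨1 + (2 * A + H) * (2 * K + 1 + S * Real.pi), fun X h hX hh hh1 => ?_⟩
  -- Beyond this threshold, `|a| ≤ A` and `h ≤ H` give `|X - ε| ≥ X - a ≥ A + H ≥ |ε|`.
  rcases le_total X (2 * A + H) with hXA | hXA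
  · rw [cauchyAverage_eq hg1 hgi X hh]
    refine (norm_sub_le _ _).trans (add_le_add (by simp) ?_)
    rw [norm_mul, Complex.norm_real, Real.norm_eq_abs, abs_of_nonneg hX]
    refine mul_le_mul hXA ?_ (norm_nonneg _) (by positivity)
    have hL' : LipschitzWith K fun s => g (X + s) :=
      LipschitzWith.of_dist_le_mul fun s t => by
        simpa using hL.dist_le_mul (X + s) (X + t)
    refine (norm_integral_div_add_mul_I_le hL' (hgi.comp_add_left X) hh).trans ?_
    have h1 : ∫ s, |g (X + s)| = 1 := by
      simp_rw [abs_of_nonneg (hg0 _)]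
      rw [integral_add_left_eq_self g X, hg1]
    rw [h1]
    gcongr
    exact hS _
  · have h1 : ‖cauchyAverage g X h‖ ≤ ∫ a, g a := by
      refine norm_integral_le_of_norm_le hgi (ae_of_all _ fun a => ?_)
      by_cases ha : g a = 0
      · simp [ha]
      rw [norm_mul, Complex.norm_real, Real.norm_eq_abs, abs_of_nonneg (hg0 a)]
      refine mul_le_of_le_one_right (hg0 a) ?_
      rw [norm_div]
      have haA := hA' a ha
      refine div_le_one_of_le₀ ?_ (norm_nonneg _)
      have h2 : ‖(a : ℂ) + h * Complex.I‖ ≤ A + H := by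
        refine (norm_add_le _ _).trans ?_
        simp only [Complex.norm_real, norm_mul, Complex.norm_I, mul_one, Real.norm_eq_abs]
        rw [abs_of_pos hh]
        linarith
      have h3 : X - a ≤ ‖(X : ℂ) - ((a : ℂ) + h * Complex.I)‖ := by
        simpa using Complex.re_le_norm ((X : ℂ) - ((a : ℂ) + h * Complex.I))
      have := le_abs_self a
      linarith
    rw [hg1] at h1
    have : 0 ≤ (2 * A + H) * (2 * (K : ℝ) + 1 + S * Real.pi) := by positivity
    linarith

/-! ### The law of the rods -/

theorem measurableSet_rodSpace (δ : ℝ) : MeasurableSet (rodSpace δ) := by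
  have h1 : MeasurableSet unitCell := by
    have : unitCell = ⋂ i, (fun x : Plane => x i) ⁻¹' Ioo (0 : ℝ) 1 := by
      ext x
      simp [unitCell]
    rw [this]
    exact MeasurableSet.iInter fun i => (by fun_prop : Measurable fun x : Plane => x i)
      measurableSet_Ioo
  have h2 : Measurable fun m : Plane × ℝ × ℂ => m.2.2.im :=
    Complex.measurable_im.comp (measurable_snd.comp measurable_snd)
  have h3 : Measurable fun m : Plane × ℝ × ℂ => Metric.infDist m.1 (frontier unitCell) :=
    measurable_infDist.comp measurable_fst
  exact (measurable_fst h1).inter (((measurable_fst.comp measurable_snd) measurableSet_Icc).inter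
    ((measurableSet_le measurable_const h2).inter
      (measurableSet_le ((measurable_fst.comp measurable_snd).add_const _) h3)))

theorem measurable_rodPoint (θ₀ : Plane) (h : ℝ) :
    Measurable fun p : ℝ × ℝ => (θ₀, p.1, (p.2 : ℂ) + h * Complex.I) :=
  measurable_const.prodMk (measurable_fst.prodMk (by fun_prop))

theorem rodLaw_eq_map (θ₀ : Plane) (γ : Measure ℝ) [SFinite γ] (g : ℝ → ℝ) (h : ℝ) :
    rodLaw θ₀ γ g h =
      (γ.prod (volume.withDensity fun a => ENNReal.ofReal (g a))).map
        fun p => (θ₀, p.1, (p.2 : ℂ) + h * Complex.I) := by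
  unfold rodLaw
  have h1 : Measurable (Complex.measurableEquivRealProd.symm ∘ fun a : ℝ => (a, h)) :=
    Complex.measurableEquivRealProd.symm.measurable.comp (by fun_prop)
  rw [Measure.prod_dirac, Measure.map_map Complex.measurableEquivRealProd.symm.measurable
    (by fun_prop), Measure.dirac_prod]
  -- Seeing `γ` as its own image under the identity makes the law a product of two image measures.
  nth_rewrite 1 [← Measure.map_id (μ := γ)]
  rw [Measure.map_prod_map _ _ measurable_id h1, Measure.map_map (by fun_prop) (measurable_id.prodMap h1)]
  congr 1
  ext p : 1
  simp only [Function.comp_apply, Prod.map, id]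
  congr 2
  apply Complex.ext <;> simp [Complex.measurableEquivRealProd]

theorem ae_mem_rodSpace {θ₀ : Plane} {ρmax δ : ℝ}
    (hball : closure (Metric.ball θ₀ ρmax) ⊆ unitCell)
    (hdist : ρmax + δ ≤ Metric.infDist θ₀ (frontier unitCell))
    {γ : Measure ℝ} [SFinite γ] (hγ : ∀ᵐ ρ ∂γ, ρ ∈ Ioc 0 ρmax) (g : ℝ → ℝ) {h : ℝ} (hh : 0 ≤ h) :
    ∀ᵐ m ∂rodLaw θ₀ γ g h, m ∈ rodSpace δ := by
  rw [rodLaw_eq_map]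
  refine (ae_map_iff (measurable_rodPoint θ₀ h).aemeasurable (measurableSet_rodSpace δ)).2 ?_
  filter_upwards [Measure.quasiMeasurePreserving_fst.ae hγ] with p hp
  have hpos : 0 < ρmax := hp.1.trans_le hp.2
  rw [closure_ball _ hpos.ne'] at hball
  -- The two horizontal extreme points of the closed ball lie in the cell, which forces `ρmax < 1 /
  -- 2`.
  have hmem : ∀ c : ℝ, |c| ≤ ρmax → θ₀ + EuclideanSpace.single 0 c ∈ unitCell := fun c hc =>
    hball (by simpa [Metric.mem_closedBall, dist_eq_norm] using hc)
  have h1 := (hmem ρmax (abs_of_pos hpos).le 0).2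
  have h2 := (hmem (-ρmax) (by rw [abs_neg, abs_of_pos hpos]) 0).1
  simp at h1 h2
  refine ⟨hball (Metric.mem_closedBall_self hpos.le), ⟨hp.1.le, ?_⟩, by simpa using hh, ?_⟩
  · show p.1 ≤ 1 / 2
    linarith [hp.2]
  · show p.1 + δ ≤ _
    linarith [hp.2]

theorem rodLaw_zero_im_pos (θ₀ : Plane) (γ : Measure ℝ) [SFinite γ] (g : ℝ → ℝ) :
    rodLaw θ₀ γ g 0 {m | 0 < m.2.2.im} = 0 := by
  have h1 : MeasurableSet {m : Plane × ℝ × ℂ | 0 < m.2.2.im} :=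
    measurableSet_lt measurable_const
      (Complex.measurable_im.comp (measurable_snd.comp measurable_snd))
  rw [rodLaw_eq_map, Measure.map_apply (measurable_rodPoint θ₀ 0) h1]
  simp

/-! ### The averaged resonant ratio -/

theorem resonantRatio_eq {k₀ ρ : ℝ} (hk : 0 < k₀) (hρ : 0 < ρ) (lam : ℝ) (θ : Plane) (a : ℝ)
    {h : ℝ} (hh : 0 < h) :
    resonantRatio k₀ lam (θ, ρ, (a : ℂ) + h * Complex.I) =
      (ρ : ℂ) ^ 2 * (((a : ℂ) + h * Complex.I) /
        (((lam / (k₀ ^ 2 * ρ ^ 2) : ℝ) : ℂ) - ((a : ℂ) + h * Complex.I))) := by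
  have h1 := sub_add_mul_I_ne_zero (lam / (k₀ ^ 2 * ρ ^ 2)) a hh
  have hk' : (k₀ : ℂ) ≠ 0 := by exact_mod_cast hk.ne'
  have hρ' : (ρ : ℂ) ≠ 0 := by exact_mod_cast hρ.ne'
  unfold resonantRatio
  dsimp only
  have h2 : (lam : ℂ) - ((a : ℂ) + h * Complex.I) * (k₀ : ℂ) ^ 2 * (ρ : ℂ) ^ 2 =
      (k₀ : ℂ) ^ 2 * (ρ : ℂ) ^ 2 *
        (((lam / (k₀ ^ 2 * ρ ^ 2) : ℝ) : ℂ) - ((a : ℂ) + h * Complex.I)) := by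
    push_cast
    field_simp
  rw [h2]
  field_simp

/-- Here `ε / (X - ε) = -1 + X / (X - ε)` with `|X - ε| ≥ h`. The bound degenerates as `h → 0` and
serves only for integrability and Fubini. -/
theorem norm_resonantRatio_le {k₀ ρ ρmax : ℝ} (hk : 0 < k₀) (hρ : ρ ∈ Ioc 0 ρmax) (lam : ℝ)
    (θ : Plane) (a : ℝ) {h : ℝ} (hh : 0 < h) :
    ‖resonantRatio k₀ lam (θ, ρ, (a : ℂ) + h * Complex.I)‖ ≤ ρmax ^ 2 + |lam| / k₀ ^ 2 / h := by
  have hρ0 := hρ.1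
  have h1 := sub_add_mul_I_ne_zero (lam / (k₀ ^ 2 * ρ ^ 2)) a hh
  have h2 : resonantRatio k₀ lam (θ, ρ, (a : ℂ) + h * Complex.I) = -((ρ ^ 2 : ℝ) : ℂ) +
      ((lam / k₀ ^ 2 : ℝ) : ℂ) /
        (((lam / (k₀ ^ 2 * ρ ^ 2) : ℝ) : ℂ) - ((a : ℂ) + h * Complex.I)) := by
    have h3 : ((lam / k₀ ^ 2 : ℝ) : ℂ) = (ρ : ℂ) ^ 2 * ((lam / (k₀ ^ 2 * ρ ^ 2) : ℝ) : ℂ) := by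
      norm_cast
      field_simp
    rw [resonantRatio_eq hk hρ0 lam θ a hh, h3]
    field_simp
    push_cast
    ring
  rw [h2]
  refine (norm_add_le _ _).trans (add_le_add ?_ ?_)
  · rw [norm_neg, Complex.norm_real, Real.norm_eq_abs, abs_of_nonneg (sq_nonneg _)]
    exact pow_le_pow_left₀ hρ0.le hρ.2 2
  · rw [norm_div, Complex.norm_real, Real.norm_eq_abs, abs_div, abs_of_pos (by positivity : 0 < k₀ ^ 2)]
    refine div_le_div_of_nonneg_left (by positivity) hh ?_
    have := Complex.abs_im_le_norm
      (((lam / (k₀ ^ 2 * ρ ^ 2) : ℝ) : ℂ) - ((a : ℂ) + h * Complex.I))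
    rw [Complex.sub_im, Complex.ofReal_im] at this
    simp only [Complex.add_im, Complex.ofReal_im, Complex.mul_im, Complex.ofReal_re, Complex.I_im,
      Complex.I_re, mul_one, mul_zero, add_zero, zero_add, zero_sub, abs_neg, abs_of_pos hh] at this
    exact this

theorem measurable_resonantRatio (k₀ lam : ℝ) : Measurable (resonantRatio k₀ lam) := by
  unfold resonantRatio
  fun_prop

theorem isFiniteMeasure_withDensity_density {g : ℝ → ℝ} (hgi : Integrable g) :
    IsFiniteMeasure (volume.withDensity fun a => ENNReal.ofReal (g a)) :=
  isFiniteMeasure_withDensity_ofReal hgi.2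

theorem integrable_resonantRatio_prod {k₀ ρmax : ℝ} (hk : 0 < k₀) {γ : Measure ℝ}
    [IsFiniteMeasure γ] (hγ : ∀ᵐ ρ ∂γ, ρ ∈ Ioc 0 ρmax) {g : ℝ → ℝ} (hgi : Integrable g) (lam : ℝ)
    (θ₀ : Plane) {h : ℝ} (hh : 0 < h) :
    Integrable (fun p : ℝ × ℝ => resonantRatio k₀ lam (θ₀, p.1, (p.2 : ℂ) + h * Complex.I))
      (γ.prod (volume.withDensity fun a => ENNReal.ofReal (g a))) := by
  have := isFiniteMeasure_withDensity_density hgi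
  refine Integrable.of_bound ((measurable_resonantRatio k₀ lam).comp
    (measurable_rodPoint θ₀ h)).aestronglyMeasurable (ρmax ^ 2 + |lam| / k₀ ^ 2 / h) ?_
  filter_upwards [Measure.quasiMeasurePreserving_fst.ae hγ] with p hp
  exact norm_resonantRatio_le hk hp lam θ₀ p.2 hh

theorem integrable_resonantRatio {k₀ ρmax : ℝ} (hk : 0 < k₀) {γ : Measure ℝ}
    [IsFiniteMeasure γ] (hγ : ∀ᵐ ρ ∂γ, ρ ∈ Ioc 0 ρmax) {g : ℝ → ℝ} (hgi : Integrable g) (lam : ℝ)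
    (θ₀ : Plane) {h : ℝ} (hh : 0 < h) :
    Integrable (resonantRatio k₀ lam) (rodLaw θ₀ γ g h) := by
  rw [rodLaw_eq_map, integrable_map_measure
    (measurable_resonantRatio k₀ lam).aestronglyMeasurable (measurable_rodPoint θ₀ h).aemeasurable]
  exact integrable_resonantRatio_prod hk hγ hgi lam θ₀ hh

theorem integral_resonantRatio {k₀ ρmax : ℝ} (hk : 0 < k₀) {γ : Measure ℝ}
    [IsFiniteMeasure γ] (hγ : ∀ᵐ ρ ∂γ, ρ ∈ Ioc 0 ρmax) {g : ℝ → ℝ} (hg0 : ∀ a, 0 ≤ g a)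
    (hgm : Measurable g) (hgi : Integrable g) (lam : ℝ) (θ₀ : Plane) {h : ℝ} (hh : 0 < h) :
    ∫ m, resonantRatio k₀ lam m ∂rodLaw θ₀ γ g h =
      ∫ ρ, (ρ : ℂ) ^ 2 * cauchyAverage g (lam / (k₀ ^ 2 * ρ ^ 2)) h ∂γ := by
  have := isFiniteMeasure_withDensity_density hgi
  rw [rodLaw_eq_map, integral_map (measurable_rodPoint θ₀ h).aemeasurable
    (measurable_resonantRatio k₀ lam).aestronglyMeasurable,
    integral_prod _ (integrable_resonantRatio_prod hk hγ hgi lam θ₀ hh)]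
  refine integral_congr_ae ?_
  filter_upwards [hγ] with ρ hρ
  unfold cauchyAverage
  rw [integral_withDensity_eq_integral_toReal_smul hgm.ennreal_ofReal (by simp),
    ← integral_const_mul]
  congr 1 with a
  rw [resonantRatio_eq hk hρ.1 lam θ₀ a hh, ENNReal.toReal_ofReal (hg0 a), Complex.real_smul]
  ring

/-! ### The shifted density -/

/-- By translation invariance the inner `L¹` norm does not depend on `ρ`. -/
theorem integrable_prod_shift {g : ℝ → ℝ} (hgm : Measurable g) (hgi : Integrable g)
    (γ : Measure ℝ) [IsFiniteMeasure γ] {X : ℝ → ℝ} (hX : Measurable X) :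
    Integrable (fun p : ℝ × ℝ => g (X p.1 + p.2)) (γ.prod volume) := by
  have hm : Measurable fun p : ℝ × ℝ => g (X p.1 + p.2) := hgm.comp (by fun_prop)
  rw [integrable_prod_iff hm.aestronglyMeasurable]
  refine ⟨ae_of_all _ fun ρ => hgi.comp_add_left (X ρ), ?_⟩
  have h1 : ∀ ρ, ∫ s, ‖g (X ρ + s)‖ = ∫ s, ‖g s‖ := fun ρ =>
    integral_add_left_eq_self (fun s => ‖g s‖) (X ρ)
  simp_rw [h1]
  exact integrable_const _

theorem measurable_resonance (k₀ lam : ℝ) :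
    Measurable fun ρ : ℝ => lam / (k₀ ^ 2 * ρ ^ 2) := by
  fun_prop

theorem shiftedDensity_eq {γ : Measure ℝ} {ρmax : ℝ} (hγ : ∀ᵐ ρ ∂γ, ρ ∈ Ioc 0 ρmax)
    (g : ℝ → ℝ) (k₀ lam s : ℝ) :
    shiftedDensity γ ρmax g k₀ lam s =
      lam / k₀ ^ 2 * ∫ ρ, g (lam / (k₀ ^ 2 * ρ ^ 2) + s) ∂γ := by
  unfold shiftedDensity
  rw [Measure.restrict_eq_self_of_ae_mem hγ]

theorem integrable_shiftedDensity {γ : Measure ℝ} [IsFiniteMeasure γ] {ρmax : ℝ}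
    (hγ : ∀ᵐ ρ ∂γ, ρ ∈ Ioc 0 ρmax) {g : ℝ → ℝ} (hgm : Measurable g) (hgi : Integrable g)
    (k₀ lam : ℝ) : Integrable (shiftedDensity γ ρmax g k₀ lam) := by
  have h1 : shiftedDensity γ ρmax g k₀ lam = fun s =>
      lam / k₀ ^ 2 * ∫ ρ, g (lam / (k₀ ^ 2 * ρ ^ 2) + s) ∂γ :=
    funext (shiftedDensity_eq hγ g k₀ lam)
  rw [h1]
  exact ((integrable_prod_shift hgm hgi γ (measurable_resonance k₀ lam)).integral_prod_right).const_mul _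

theorem integrable_shift {γ : Measure ℝ} [IsFiniteMeasure γ] {g : ℝ → ℝ} (hgm : Measurable g)
    {S : ℝ} (hS : ∀ a, ‖g a‖ ≤ S) (k₀ lam s : ℝ) :
    Integrable (fun ρ : ℝ => g (lam / (k₀ ^ 2 * ρ ^ 2) + s)) γ :=
  Integrable.of_bound (hgm.comp ((measurable_resonance k₀ lam).add_const s)).aestronglyMeasurable S
    (ae_of_all _ fun _ => hS _)

theorem lipschitzWith_shiftedDensity {γ : Measure ℝ} [IsProbabilityMeasure γ] {ρmax : ℝ}
    (hγ : ∀ᵐ ρ ∂γ, ρ ∈ Ioc 0 ρmax) {g : ℝ → ℝ} {K : NNReal} (hL : LipschitzWith K g)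
    {S : ℝ} (hS : ∀ a, ‖g a‖ ≤ S) (k₀ lam : ℝ) :
    LipschitzWith (‖lam / k₀ ^ 2‖₊ * K) (shiftedDensity γ ρmax g k₀ lam) := by
  refine LipschitzWith.of_dist_le_mul fun s t => ?_
  have hgm := hL.continuous.measurable
  rw [shiftedDensity_eq hγ, shiftedDensity_eq hγ, Real.dist_eq, ← mul_sub, abs_mul,
    ← integral_sub (integrable_shift hgm hS k₀ lam s) (integrable_shift hgm hS k₀ lam t)]
  push_cast
  rw [mul_assoc]
  refine mul_le_mul_of_nonneg_left ?_ (abs_nonneg _)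
  have h1 := norm_integral_le_of_norm_le_const (μ := γ) (C := K * dist s t)
    (f := fun ρ => g (lam / (k₀ ^ 2 * ρ ^ 2) + s) - g (lam / (k₀ ^ 2 * ρ ^ 2) + t))
    (ae_of_all _ fun ρ => by
      have := hL.dist_le_mul (lam / (k₀ ^ 2 * ρ ^ 2) + s) (lam / (k₀ ^ 2 * ρ ^ 2) + t)
      rwa [dist_add_left, dist_eq_norm (g _)] at this)
  simpa using h1

/-- The product `ρ² X = lam / k₀²` is independent of `ρ`, so it leaves the integral, and Fubini
assembles the shifted density. -/
theorem integral_sq_mul_cauchyAverage {γ : Measure ℝ} [IsProbabilityMeasure γ] {ρmax : ℝ}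
    (hγ : ∀ᵐ ρ ∂γ, ρ ∈ Ioc 0 ρmax) {g : ℝ → ℝ} (hg1 : ∫ a, g a = 1)
    (hgm : Measurable g) (hgi : Integrable g) {k₀ : ℝ} (hk : 0 < k₀) (lam : ℝ) {h : ℝ}
    (hh : 0 < h) :
    ∫ ρ, (ρ : ℂ) ^ 2 * cauchyAverage g (lam / (k₀ ^ 2 * ρ ^ 2)) h ∂γ =
      -((∫ ρ in Ioc 0 ρmax, ρ ^ 2 ∂γ : ℝ) : ℂ) -
        ∫ s, (shiftedDensity γ ρmax g k₀ lam s : ℂ) / ((s : ℂ) + h * Complex.I) := by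
  have h2 : Integrable (fun p : ℝ × ℝ =>
      (g (lam / (k₀ ^ 2 * p.1 ^ 2) + p.2) : ℂ) * ((p.2 : ℂ) + h * Complex.I)⁻¹)
      (γ.prod volume) := by
    refine (integrable_prod_shift hgm hgi γ (measurable_resonance k₀ lam)).ofReal.mul_bdd
      (c := h⁻¹) ((continuous_inv_add_mul_I hh).comp continuous_snd).aestronglyMeasurable
      (ae_of_all _ fun p => ?_)
    rw [norm_inv]
    exact inv_anti₀ hh ((le_abs_self h).trans (le_norm_add_mul_I p.2 h))
  have h3 : ∫ ρ, (ρ : ℂ) ^ 2 * cauchyAverage g (lam / (k₀ ^ 2 * ρ ^ 2)) h ∂γ =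
      ∫ ρ, (-((ρ ^ 2 : ℝ) : ℂ) - ((lam / k₀ ^ 2 : ℝ) : ℂ) *
        ∫ s, (g (lam / (k₀ ^ 2 * ρ ^ 2) + s) : ℂ) * ((s : ℂ) + h * Complex.I)⁻¹) ∂γ := by
    refine integral_congr_ae ?_
    filter_upwards [hγ] with ρ hρ
    have hρ0 := hρ.1.ne'
    have h4 : ((lam / k₀ ^ 2 : ℝ) : ℂ) = (ρ : ℂ) ^ 2 * ((lam / (k₀ ^ 2 * ρ ^ 2) : ℝ) : ℂ) := by
      norm_cast
      field_simp
    rw [cauchyAverage_eq hg1 hgi _ hh, h4]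
    simp_rw [div_eq_mul_inv]
    push_cast
    ring
  have h5 : Integrable (fun ρ : ℝ => ρ ^ 2) γ := by
    refine Integrable.of_bound (by fun_prop) (ρmax ^ 2) ?_
    filter_upwards [hγ] with ρ hρ
    rw [Real.norm_eq_abs, abs_of_nonneg (sq_nonneg _)]
    exact pow_le_pow_left₀ hρ.1.le hρ.2 2
  have h6 : Integrable (fun ρ : ℝ => -((ρ ^ 2 : ℝ) : ℂ)) γ := h5.ofReal.neg
  have h7 : Integrable (fun ρ : ℝ => ∫ s, (g (lam / (k₀ ^ 2 * ρ ^ 2) + s) : ℂ) *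
      ((s : ℂ) + h * Complex.I)⁻¹) γ := h2.integral_prod_left
  rw [h3, integral_sub h6 (h7.const_mul _), integral_neg,
    integral_complex_ofReal, integral_const_mul, integral_integral_swap h2,
    Measure.restrict_eq_self_of_ae_mem hγ, ← integral_const_mul]
  congr 2 with s
  rw [integral_mul_const, integral_complex_ofReal, shiftedDensity_eq hγ, div_eq_mul_inv]
  push_cast
  ring

/-! ### The sum of the squared means. -/

theorem diskMeasure_univ : diskMeasure univ = ENNReal.ofReal Real.pi := by
  unfold diskMeasure unitDisk
  rw [Measure.restrict_apply_univ, EuclideanSpace.volume_ball_fin_two]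
  simp [ENNReal.ofReal, Real.toNNReal_of_nonneg Real.pi_pos.le]

instance isFiniteMeasure_diskMeasure : IsFiniteMeasure diskMeasure :=
  ⟨by rw [diskMeasure_univ]; exact ENNReal.ofReal_lt_top⟩

/-- Parseval's identity for the constant function `1`, whose squared norm is the area of the disk.
-/
theorem hasSum_sq_eigenMean (φ : HilbertBasis ℕ ℝ (Lp ℝ 2 diskMeasure)) :
    HasSum (fun n => eigenMean φ n ^ 2) Real.pi := by
  have hu : diskMeasure univ ≠ ⊤ := measure_ne_top _ _
  set e : Lp ℝ 2 diskMeasure := indicatorConstLp 2 MeasurableSet.univ hu 1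
  have h1 : ∀ f : Lp ℝ 2 diskMeasure, inner ℝ e f = ∫ x, f x ∂diskMeasure := fun f => by
    rw [L2.inner_indicatorConstLp_one, setIntegral_univ]
  have h2 : inner ℝ e e = Real.pi := by
    rw [L2.inner_indicatorConstLp_one]
    rw [integral_congr_ae (ae_restrict_of_ae (indicatorConstLp_coeFn (p := 2)
      (hs := MeasurableSet.univ) (hμs := hu) (c := (1 : ℝ))))]
    simp [measureReal_def, diskMeasure_univ, Real.pi_pos.le]
  have h3 := φ.hasSum_inner_mul_inner e e
  rw [h2] at h3
  have h4 : ∀ n, inner ℝ e (φ n) * inner ℝ (φ n) e = eigenMean φ n ^ 2 := fun n => by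
    rw [real_inner_comm e, h1, eigenMean, sq]
  simpa only [h4] using h3

/-! ### Positivity of the eigenvalues -/

theorem tendsto_integral_inner_of_eLpNorm {α E : Type*} [MeasurableSpace α] {μ : Measure α}
    [NormedAddCommGroup E] [InnerProductSpace ℝ E] {f w : α → E} {v : ℕ → α → E}
    (hf : MemLp f 2 μ) (hv : ∀ k, MemLp (v k) 2 μ) (hw : MemLp w 2 μ)
    (h : Tendsto (fun k => eLpNorm (fun x => v k x - w x) 2 μ) atTop (𝓝 0)) :
    Tendsto (fun k => ∫ x, inner ℝ (f x) (v k x) ∂μ) atTop (𝓝 (∫ x, inner ℝ (f x) (w x) ∂μ)) := by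
  have h1 : ∀ {z : α → E} (hz : MemLp z 2 μ),
      inner ℝ (hf.toLp f) (hz.toLp z) = ∫ x, inner ℝ (f x) (z x) ∂μ := by
    intro z hz
    rw [L2.inner_def]
    refine integral_congr_ae ?_
    filter_upwards [hf.coeFn_toLp, hz.coeFn_toLp] with x h1 h2
    rw [h1, h2]
  have h2 : Tendsto (fun k => (hv k).toLp (v k)) atTop (𝓝 (hw.toLp w)) :=
    (Lp.tendsto_Lp_iff_tendsto_eLpNorm'' v hv w hw).2 h
  have h3 := (tendsto_const_nhds (x := hf.toLp f)).inner h2 (𝕜 := ℝ)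
  simpa only [h1] using h3

theorem norm_gradient (ψ : Plane → ℝ) (x : Plane) : ‖gradient ψ x‖ = ‖fderiv ℝ ψ x‖ := by
  simp [gradient]

theorem IsDiskTest.memLp {ψ : Plane → ℝ} (hψ : IsDiskTest ψ) : MemLp ψ 2 diskMeasure :=
  (hψ.1.continuous.memLp_of_hasCompactSupport hψ.2.1).restrict _

theorem IsDiskTest.memLp_gradient {ψ : Plane → ℝ} (hψ : IsDiskTest ψ) :
    MemLp (gradient ψ) 2 diskMeasure := by
  have h1 : Continuous (gradient ψ) :=
    (InnerProductSpace.toDual ℝ Plane).symm.continuous.comp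
      (hψ.1.continuous_fderiv (by simp))
  have h2 : HasCompactSupport (gradient ψ) :=
    (hψ.2.1.fderiv ℝ).comp_left (g := (InnerProductSpace.toDual ℝ Plane).symm) (by simp)
  exact (h1.memLp_of_hasCompactSupport h2).restrict _

/-- The Poincaré inequality in the unit disk. -/
theorem exists_poincare_const : ∃ C : ENNReal, C ≠ ⊤ ∧ ∀ ψ : Plane → ℝ, IsDiskTest ψ →
    eLpNorm ψ 2 diskMeasure ≤ C * eLpNorm (gradient ψ) 2 diskMeasure := by
  refine ⟨eLpNormLESNormFDerivOfLeConst ℝ (volume : Measure Plane) unitDisk 1 2 *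
    diskMeasure univ ^ (1 / (1 : ENNReal).toReal - 1 / (2 : ENNReal).toReal),
    ENNReal.mul_ne_top ENNReal.coe_ne_top
      (ENNReal.rpow_ne_top_of_nonneg (by norm_num) (measure_ne_top _ _)), fun ψ hψ => ?_⟩
  -- In dimension two the Sobolev exponent of `p = 1` is exactly `2`; Hölder on the finite measure
  -- then passes from the `L¹` to the `L²` norm of the gradient.
  have h1 := eLpNorm_le_eLpNorm_fderiv_of_le (F := ℝ) (volume : Measure Plane)
    (hψ.1.of_le (by simp)) ((subset_tsupport ψ).trans hψ.2.2) (p := 1) (q := 2) le_rfl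
    (by simp) (by simp; norm_num) Metric.isBounded_ball
  have h2 : eLpNorm (fderiv ℝ ψ) 1 volume = eLpNorm (gradient ψ) 1 diskMeasure := by
    rw [← eLpNorm_restrict_eq_of_support_subset (f := fderiv ℝ ψ)
      (((subset_tsupport _).trans (tsupport_fderiv_subset ℝ)).trans hψ.2.2)]
    exact eLpNorm_congr_norm_ae (ae_of_all _ fun x => (norm_gradient ψ x).symm)
  have h3 := eLpNorm_le_eLpNorm_mul_rpow_measure_univ (p := 1) (q := 2) (by norm_num)
    hψ.memLp_gradient.aestronglyMeasurable
  calc eLpNorm ψ 2 diskMeasure ≤ eLpNorm ψ 2 volume := eLpNorm_mono_measure _ Measure.restrict_le_self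
    _ ≤ _ := h1
    _ ≤ _ := by
      simp only [ENNReal.coe_one]
      rw [h2, mul_assoc, mul_comm (diskMeasure univ ^ _)]
      gcongr

/-- Testing the equation with the approximants of `u` gives `∫ |G|² = lam` in the limit. If `lam =
0`, their gradients tend to `0`, hence so do they by Poincaré, contradicting the normalization of
`u`. -/
theorem IsDirichletEigenfunction.pos {lam : ℝ} {u : Plane → ℝ} (h : IsDirichletEigenfunction lam u)
    (hu : ∫ x, u x ^ 2 ∂diskMeasure = 1) : 0 < lam := by
  obtain ⟨G, ⟨hum, hGm, ψ, hψ, hψu, hψG⟩, hw⟩ := h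
  have h1 := tendsto_integral_inner_of_eLpNorm hGm (fun k => (hψ k).memLp_gradient) hGm hψG
  have h2 := (tendsto_integral_inner_of_eLpNorm hum (fun k => (hψ k).memLp) hum hψu).const_mul lam
  have h3 : ∫ x, inner ℝ (G x) (G x) ∂diskMeasure = lam := by
    refine (tendsto_nhds_unique h1 (h2.congr fun k => ?_)).trans ?_
    · rw [hw _ (hψ k)]
      simp [mul_comm]
    · simp only [real_inner_self_eq_norm_sq, Real.norm_eq_abs, sq_abs, hu, mul_one]
  have h4 : 0 ≤ lam := by
    rw [← h3]
    exact integral_nonneg fun x => real_inner_self_nonneg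
  refine h4.lt_of_ne fun h0 => ?_
  have h5 : G =ᵐ[diskMeasure] 0 := by
    have h6 : Integrable (fun x => ‖G x‖ ^ 2) diskMeasure :=
      (memLp_two_iff_integrable_sq_norm hGm.1).1 hGm
    simp only [real_inner_self_eq_norm_sq] at h3
    rw [← h0, integral_eq_zero_iff_of_nonneg (fun x => sq_nonneg _) h6] at h3
    filter_upwards [h3] with x hx
    simpa using hx
  obtain ⟨C, hC, hP⟩ := exists_poincare_const
  have h7 : Tendsto (fun k => eLpNorm (ψ k) 2 diskMeasure) atTop (𝓝 0) := by
    have h8 : Tendsto (fun k => C * eLpNorm (gradient (ψ k)) 2 diskMeasure) atTop (𝓝 0) := by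
      have h9 := ENNReal.Tendsto.const_mul hψG (Or.inr hC)
      rw [mul_zero] at h9
      refine h9.congr fun k => ?_
      congr 1
      refine eLpNorm_congr_ae ?_
      filter_upwards [h5] with x hx
      simp [hx]
    exact tendsto_of_tendsto_of_tendsto_of_le_of_le tendsto_const_nhds h8 (fun _ => zero_le)
      fun k => hP _ (hψ k)
  have h10 : eLpNorm u 2 diskMeasure = 0 := by
    have h11 := h7.add hψu
    rw [add_zero] at h11
    refine le_antisymm (ge_of_tendsto h11 (Eventually.of_forall fun k => ?_)) zero_le
    have h12 : u = ψ k - fun x => ψ k x - u x := by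
      ext x
      simp
    calc eLpNorm u 2 diskMeasure = eLpNorm (ψ k - fun x => ψ k x - u x) 2 diskMeasure := by
          rw [← h12]
      _ ≤ _ := eLpNorm_sub_le (hψ k).memLp.1 ((hψ k).memLp.1.sub hum.1) (by norm_num)
  rw [eLpNorm_eq_zero_iff hum.1 (by norm_num)] at h10
  have h13 : ∫ x, u x ^ 2 ∂diskMeasure = 0 := by
    rw [integral_congr_ae (g := fun _ => 0)]
    · simp
    · filter_upwards [h10] with x hx
      simp [hx]
  linarith

theorem IsDirichletEigenbasis.pos {lam : ℕ → ℝ} {φ : HilbertBasis ℕ ℝ (Lp ℝ 2 diskMeasure)}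
    (h : IsDirichletEigenbasis lam φ) (n : ℕ) : 0 < lam n := by
  refine (h.2 n).pos ?_
  have h1 : inner ℝ (φ n) (φ n) = (1 : ℝ) := by
    rw [real_inner_self_eq_norm_sq, φ.orthonormal.1 n, one_pow]
  rw [L2.inner_def] at h1
  simpa only [real_inner_self_eq_norm_sq, Real.norm_eq_abs, sq_abs] using h1

/-! ### Positivity of the shifted density at `0`. -/

theorem shiftedDensity_nonneg {γ : Measure ℝ} {ρmax : ℝ} {g : ℝ → ℝ} (hg0 : ∀ a, 0 ≤ g a)
    {lam : ℝ} (hlam : 0 ≤ lam) (k₀ s : ℝ) : 0 ≤ shiftedDensity γ ρmax g k₀ lam s :=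
  mul_nonneg (div_nonneg hlam (sq_nonneg _)) (integral_nonneg fun _ => hg0 _)

theorem exists_interval_shiftedDensity_zero_pos {γ : Measure ℝ} [IsProbabilityMeasure γ]
    {ρmax : ℝ} (hγ : ∀ᵐ ρ ∂γ, ρ ∈ Ioc 0 ρmax) {g : ℝ → ℝ} (hg0 : ∀ a, 0 ≤ g a)
    (hgc : Continuous g) {S : ℝ} (hS : ∀ a, ‖g a‖ ≤ S) {a : ℝ} (ha : 0 < a) (hga : 0 < g a)
    {lam : ℝ} (hlam : 0 < lam) :
    ∃ k₁ k₂ : ℝ, 0 < k₁ ∧ k₁ < k₂ ∧ ∀ k₀ ∈ Ioo k₁ k₂, 0 < shiftedDensity γ ρmax g k₀ lam 0 := by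
  have hpos : 0 < γ (Ioc 0 ρmax) := by
    rw [(prob_compl_eq_zero_iff measurableSet_Ioc).1 hγ]
    exact one_pos
  obtain ⟨ρ, hρ, hρs⟩ := Measure.nonempty_inter_support_of_pos hpos
  have hρ0 := hρ.1
  -- The wave number at which a rod of radius `ρ` in the support of `γ` resonates at permittivity
  -- `a`.
  set k := Real.sqrt (lam / (a * ρ ^ 2))
  have hk : 0 < k := Real.sqrt_pos.2 (by positivity)
  have hka : lam / (k ^ 2 * ρ ^ 2) = a := by
    rw [Real.sq_sqrt (by positivity)]
    field_simp
  have hc : ContinuousAt (fun p : ℝ × ℝ => g (lam / (p.1 ^ 2 * p.2 ^ 2) + 0)) (k, ρ) := by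
    refine hgc.continuousAt.comp (ContinuousAt.add (ContinuousAt.div ?_ ?_ ?_) ?_)
    · fun_prop
    · fun_prop
    · positivity
    · fun_prop
  have hev : ∀ᶠ p in 𝓝 (k, ρ), 0 < g (lam / (p.1 ^ 2 * p.2 ^ 2) + 0) :=
    hc.eventually (lt_mem_nhds (by simpa [hka] using hga))
  rw [nhds_prod_eq] at hev
  obtain ⟨P, hP, Q, hQ, hPQ⟩ := eventually_prod_iff.1 hev
  obtain ⟨k₁, k₂, hkI, hIP⟩ := mem_nhds_iff_exists_Ioo_subset.1
    (inter_mem hP (Ioi_mem_nhds hk))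
  refine ⟨max k₁ (k / 2), k₂, lt_max_of_lt_right (half_pos hk),
    max_lt (hkI.1.trans hkI.2) ((half_lt_self hk).trans hkI.2), fun k₀ hk₀ => ?_⟩
  have hk₀' := hIP ⟨(le_max_left _ _).trans_lt hk₀.1, hk₀.2⟩
  have hk₀pos : 0 < k₀ := hk₀'.2
  rw [shiftedDensity_eq hγ]
  refine mul_pos (by positivity) ?_
  rw [integral_pos_iff_support_of_nonneg (fun _ => hg0 _)
    (integrable_shift hgc.measurable hS k₀ lam 0)]
  -- Neighbourhoods of a point of the support have positive measure, and on this one the integrand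
  -- is positive for every `k₀` in the interval.
  refine ((Measure.mem_support_iff_forall ρ).1 hρs _ hQ).trans_le (measure_mono fun x hx => ?_)
  exact (hPQ hk₀'.1 hx).ne'

/-! ### Imaginary part of the limit, and passage to the limit in the series. -/

section Limit

variable {lam : ℕ → ℝ} {φ : HilbertBasis ℕ ℝ (Lp ℝ 2 diskMeasure)} {θ₀ : Plane} {ρmax δ : ℝ}
  {γ : Measure ℝ} {g : ℝ → ℝ} {K : NNReal} {k₀ : ℝ}

theorem im_limitTerm (n : ℕ) :
    (limitTerm lam φ γ ρmax g k₀ n).im =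
      eigenMean φ n ^ 2 * (Real.pi * shiftedDensity γ ρmax g k₀ (lam n) 0) := by
  have h1 : limitTerm lam φ γ ρmax g k₀ n = ((eigenMean φ n ^ 2 *
      -(principalValue fun s => shiftedDensity γ ρmax g k₀ (lam n) s / s) : ℝ) : ℂ) +
      ((eigenMean φ n ^ 2 * (Real.pi * shiftedDensity γ ρmax g k₀ (lam n) 0) : ℝ) : ℂ) *
        Complex.I := by
    unfold limitTerm
    push_cast
    ring
  rw [h1, Complex.add_im, Complex.ofReal_im, Complex.im_ofReal_mul, Complex.I_im]
  ring

theorem hasSum_im_limitPermeability (h : Summable (limitTerm lam φ γ ρmax g k₀)) :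
    HasSum (fun n => eigenMean φ n ^ 2 * (Real.pi * shiftedDensity γ ρmax g k₀ (lam n) 0))
      (limitPermeability lam φ γ ρmax g k₀).im := by
  have h1 := Complex.hasSum_im h.hasSum
  simp only [im_limitTerm] at h1
  unfold limitPermeability
  rw [← Complex.ofReal_mul, ← Complex.ofReal_one, ← Complex.ofReal_sub, Complex.add_im,
    Complex.ofReal_im, zero_add]
  exact h1

variable [IsProbabilityMeasure γ]

theorem permeabilityTerm_eq
    (hmem : ∀ h > 0, ∀ᵐ m ∂rodLaw θ₀ γ g h, m ∈ rodSpace δ) (hγ : ∀ᵐ ρ ∂γ, ρ ∈ Ioc 0 ρmax)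
    (hg0 : ∀ a, 0 ≤ g a) (hgm : Measurable g) (hgi : Integrable g) (hk : 0 < k₀) {h : ℝ}
    (hh : 0 < h) (n : ℕ) :
    permeabilityTerm lam φ δ (rodLaw θ₀ γ g h) k₀ n = (eigenMean φ n : ℂ) ^ 2 *
      ∫ ρ, (ρ : ℂ) ^ 2 * cauchyAverage g (lam n / (k₀ ^ 2 * ρ ^ 2)) h ∂γ := by
  unfold permeabilityTerm
  rw [Measure.restrict_eq_self_of_ae_mem (hmem h hh),
    integral_resonantRatio hk hγ hg0 hgm hgi (lam n) θ₀ hh]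

theorem norm_integral_sq_mul_cauchyAverage_le (hγ : ∀ᵐ ρ ∂γ, ρ ∈ Ioc 0 ρmax) {C H : ℝ}
    (hCb : ∀ X h : ℝ, 0 ≤ X → 0 < h → h ≤ H → ‖cauchyAverage g X h‖ ≤ C) {l : ℝ} (hl : 0 ≤ l)
    {h : ℝ} (hh : 0 < h) (hhH : h ≤ H) :
    ‖∫ ρ, (ρ : ℂ) ^ 2 * cauchyAverage g (l / (k₀ ^ 2 * ρ ^ 2)) h ∂γ‖ ≤ ρmax ^ 2 * C := by
  have h1 := norm_integral_le_of_norm_le_const (μ := γ) (C := ρmax ^ 2 * C)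
    (f := fun ρ : ℝ => (ρ : ℂ) ^ 2 * cauchyAverage g (l / (k₀ ^ 2 * ρ ^ 2)) h) (by
      filter_upwards [hγ] with ρ hρ
      rw [norm_mul, norm_pow, Complex.norm_real, Real.norm_eq_abs, sq_abs]
      exact mul_le_mul (pow_le_pow_left₀ hρ.1.le hρ.2 2) (hCb _ _ (by positivity) hh hhH)
        (norm_nonneg _) (sq_nonneg _))
  simpa using h1

theorem tendsto_integral_sq_mul_cauchyAverage (hγ : ∀ᵐ ρ ∂γ, ρ ∈ Ioc 0 ρmax)
    (hg1 : ∫ a, g a = 1) (hgi : Integrable g) (hL : LipschitzWith K g) {S : ℝ}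
    (hS : ∀ a, ‖g a‖ ≤ S) (hk : 0 < k₀) (l : ℝ) :
    Tendsto (fun h : ℝ => ∫ ρ, (ρ : ℂ) ^ 2 * cauchyAverage g (l / (k₀ ^ 2 * ρ ^ 2)) h ∂γ) (𝓝[>] 0)
      (𝓝 (-((∫ ρ in Ioc 0 ρmax, ρ ^ 2 ∂γ : ℝ) : ℂ) +
        (-(principalValue fun s => shiftedDensity γ ρmax g k₀ l s / s : ℂ) +
          Complex.I * (Real.pi : ℂ) * (shiftedDensity γ ρmax g k₀ l 0 : ℂ)))) := by
  have hgm := hL.continuous.measurable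
  have hfL := lipschitzWith_shiftedDensity hγ hL hS k₀ l
  have hfi := integrable_shiftedDensity hγ hgm hgi k₀ l
  have h1 := (tendsto_integral_div_add_mul_I hfL hfi).const_sub
    (-((∫ ρ in Ioc 0 ρmax, ρ ^ 2 ∂γ : ℝ) : ℂ))
  rw [(hasPrincipalValue_div hfL hfi).principalValue_eq]
  convert h1.congr' ?_ using 2
  · ring
  · filter_upwards [self_mem_nhdsWithin] with h hh
    rw [integral_sq_mul_cauchyAverage hγ hg1 hgm hgi hk l hh]

theorem exists_norm_permeabilityTerm_le
    (hlam : ∀ n, 0 ≤ lam n) (hmem : ∀ h > 0, ∀ᵐ m ∂rodLaw θ₀ γ g h, m ∈ rodSpace δ)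
    (hγ : ∀ᵐ ρ ∂γ, ρ ∈ Ioc 0 ρmax) (hg0 : ∀ a, 0 ≤ g a) (hg1 : ∫ a, g a = 1)
    (hgi : Integrable g) (hL : LipschitzWith K g) (hgc : HasCompactSupport g) (hk : 0 < k₀)
    {H : ℝ} (hH : 0 ≤ H) : ∃ C, ∀ h ∈ Ioc 0 H, ∀ n,
      ‖permeabilityTerm lam φ δ (rodLaw θ₀ γ g h) k₀ n‖ ≤ eigenMean φ n ^ 2 * C := by
  obtain ⟨C, hCb⟩ := exists_cauchyAverage_bound hg0 hg1 hgi hL hgc hH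
  refine ⟨ρmax ^ 2 * C, fun h hh n => ?_⟩
  rw [permeabilityTerm_eq hmem hγ hg0 hL.continuous.measurable hgi hk hh.1, norm_mul, norm_pow,
    Complex.norm_real, Real.norm_eq_abs, sq_abs]
  exact mul_le_mul_of_nonneg_left
    (norm_integral_sq_mul_cauchyAverage_le hγ hCb (hlam n) hh.1 hh.2) (sq_nonneg _)

theorem summable_permeabilityTerm
    (hlam : ∀ n, 0 ≤ lam n) (hmem : ∀ h > 0, ∀ᵐ m ∂rodLaw θ₀ γ g h, m ∈ rodSpace δ)
    (hγ : ∀ᵐ ρ ∂γ, ρ ∈ Ioc 0 ρmax) (hg0 : ∀ a, 0 ≤ g a) (hg1 : ∫ a, g a = 1)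
    (hgi : Integrable g) (hL : LipschitzWith K g) (hgc : HasCompactSupport g) (hk : 0 < k₀)
    {h : ℝ} (hh : 0 < h) :
    Summable (permeabilityTerm lam φ δ (rodLaw θ₀ γ g h) k₀) := by
  obtain ⟨C, hC⟩ := exists_norm_permeabilityTerm_le (φ := φ) hlam hmem hγ hg0 hg1 hgi hL hgc hk
    hh.le
  exact Summable.of_norm_bounded ((hasSum_sq_eigenMean φ).summable.mul_right C)
    (hC h ⟨hh, le_rfl⟩)

/-- Dominated convergence for series, with majorant `C c_n²`. Each limit splits into `-c_n² ∫ ρ²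
dγ`, summed by Parseval, and the limit term. -/
theorem summable_limitTerm_and_tendsto_effPermeability
    (hlam : ∀ n, 0 ≤ lam n) (hmem : ∀ h > 0, ∀ᵐ m ∂rodLaw θ₀ γ g h, m ∈ rodSpace δ)
    (hγ : ∀ᵐ ρ ∂γ, ρ ∈ Ioc 0 ρmax) (hg0 : ∀ a, 0 ≤ g a) (hg1 : ∫ a, g a = 1)
    (hgi : Integrable g) (hL : LipschitzWith K g) (hgc : HasCompactSupport g) (hk : 0 < k₀) :
    Summable (limitTerm lam φ γ ρmax g k₀) ∧
      Tendsto (fun h : ℝ => effPermeability lam φ δ (rodLaw θ₀ γ g h) k₀) (𝓝[>] 0)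
        (𝓝 (limitPermeability lam φ γ ρmax g k₀)) := by
  have hgm := hL.continuous.measurable
  obtain ⟨S, hS⟩ := hgc.exists_bound_of_continuous hL.continuous
  obtain ⟨C, hC⟩ := exists_norm_permeabilityTerm_le (φ := φ) hlam hmem hγ hg0 hg1 hgi hL hgc hk
    one_pos.le
  set R : ℂ := ((∫ ρ in Ioc 0 ρmax, ρ ^ 2 ∂γ : ℝ) : ℂ)
  have hc := hasSum_sq_eigenMean φ
  have hsum : Summable fun n => eigenMean φ n ^ 2 * C := hc.summable.mul_right _
  have hT : ∀ n, Tendsto (fun h : ℝ => permeabilityTerm lam φ δ (rodLaw θ₀ γ g h) k₀ n) (𝓝[>] 0)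
      (𝓝 (-((eigenMean φ n ^ 2 : ℝ) : ℂ) * R + limitTerm lam φ γ ρmax g k₀ n)) := fun n => by
    have h1 := (tendsto_integral_sq_mul_cauchyAverage hγ hg1 hgi hL hS hk (lam n)).const_mul
      ((eigenMean φ n : ℂ) ^ 2)
    convert h1.congr' ?_ using 2
    · unfold limitTerm
      push_cast
      ring
    · filter_upwards [self_mem_nhdsWithin] with h hh
      rw [permeabilityTerm_eq hmem hγ hg0 hgm hgi hk hh]
  have hB : ∀ᶠ h : ℝ in 𝓝[>] 0, ∀ n,
      ‖permeabilityTerm lam φ δ (rodLaw θ₀ γ g h) k₀ n‖ ≤ eigenMean φ n ^ 2 * C := by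
    filter_upwards [Ioc_mem_nhdsGT one_pos] with h hh
    exact hC h hh
  have hR : HasSum (fun n => -((eigenMean φ n ^ 2 : ℝ) : ℂ) * R) (-(Real.pi : ℂ) * R) :=
    ((Complex.hasSum_ofReal.2 hc).neg).mul_right R
  have hsum' : Summable fun n =>
      -((eigenMean φ n ^ 2 : ℝ) : ℂ) * R + limitTerm lam φ γ ρmax g k₀ n :=
    -- The majorant survives the limit `h → 0+`, which yields the summability of the limit terms.
    Summable.of_norm_bounded hsum fun n =>
      le_of_tendsto (hT n).norm (hB.mono fun h hh => hh n)
  have hlim : Summable (limitTerm lam φ γ ρmax g k₀) := by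
    simpa using hsum'.sub hR.summable
  refine ⟨hlim, ?_⟩
  have h1 := (tendsto_tsum_of_dominated_convergence hsum hT hB).const_add 1
  rw [hR.summable.tsum_add hlim, hR.tsum_eq] at h1
  have h2 : limitPermeability lam φ γ ρmax g k₀ =
      1 + (-(Real.pi : ℂ) * R + ∑' n, limitTerm lam φ γ ρmax g k₀ n) := by
    unfold limitPermeability
    ring
  rw [h2]
  exact h1

end Limit

end RandomRods

theorem proposition3p1
    -- an orthonormal basis of Dirichlet eigenfunctions of the unit disk, and the eigenvalues
    (lam : ℕ → ℝ) (φ : HilbertBasis ℕ ℝ (Lp ℝ 2 RandomRods.diskMeasure))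
    (hφ : RandomRods.IsDirichletEigenbasis lam φ)
    -- the centre, the maximal radius and the safety distance
    (θ₀ : RandomRods.Plane) (ρmax δ : ℝ) (hδ : 0 < δ) (hδ' : δ < 1 / 2)
    (hball : closure (Metric.ball θ₀ ρmax) ⊆ RandomRods.unitCell)
    (hdist : ρmax + δ ≤ Metric.infDist θ₀ (frontier RandomRods.unitCell))
    -- the law of the radius, concentrated on `(0, ρmax]`
    (γ : Measure ℝ) [IsProbabilityMeasure γ] (hγ : γ (Ioc 0 ρmax)ᶜ = 0)
    -- the probability density of the real permittivity
    (g : ℝ → ℝ) (hg0 : ∀ a, 0 ≤ g a) (hg1 : ∫ a, g a = 1)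
    (hgL : ∃ K, LipschitzWith K g) (hgc : HasCompactSupport g) :
    -- convergence of the permeability, every integral, series and limit in it being meaningful
    (∀ k₀ : ℝ, 0 < k₀ →
      (∀ h > 0, ∀ n, IntegrableOn (RandomRods.resonantRatio k₀ (lam n)) (RandomRods.rodSpace δ)
        (RandomRods.rodLaw θ₀ γ g h)) ∧
      (∀ h > 0, Summable
        (RandomRods.permeabilityTerm lam φ δ (RandomRods.rodLaw θ₀ γ g h) k₀)) ∧
      (∀ n, RandomRods.HasPrincipalValue
        (fun s => RandomRods.shiftedDensity γ ρmax g k₀ (lam n) s / s)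
        (RandomRods.principalValue
          fun s => RandomRods.shiftedDensity γ ρmax g k₀ (lam n) s / s)) ∧
      Summable (RandomRods.limitTerm lam φ γ ρmax g k₀) ∧
      Tendsto
        (fun h : ℝ =>
          RandomRods.effPermeability lam φ δ (RandomRods.rodLaw θ₀ γ g h) k₀)
        (𝓝[>] 0) (𝓝 (RandomRods.limitPermeability lam φ γ ρmax g k₀)) ∧
      0 ≤ (RandomRods.limitPermeability lam φ γ ρmax g k₀).im) ∧
    -- the law at `h = 0` is non-dissipative
    RandomRods.rodLaw θ₀ γ g 0 {m | 0 < m.2.2.im} = 0 ∧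
    -- and yet the limit has a positive imaginary part on some interval of wave numbers
    ((∃ a > 0, 0 < g a) →
      ∃ k₁ k₂ : ℝ, 0 < k₁ ∧ k₁ < k₂ ∧ ∀ k₀ ∈ Ioo k₁ k₂,
        0 < (RandomRods.limitPermeability lam φ γ ρmax g k₀).im) := by
  obtain ⟨K, hL⟩ := hgL
  have hγ' : ∀ᵐ ρ ∂γ, ρ ∈ Ioc 0 ρmax := hγ
  have hgi : Integrable g := hL.continuous.integrable_of_hasCompactSupport hgc
  obtain ⟨S, hS⟩ := hgc.exists_bound_of_continuous hL.continuous
  have hlam : ∀ n, 0 < lam n := hφ.pos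
  have hmem : ∀ h > 0, ∀ᵐ m ∂(RandomRods.rodLaw θ₀ γ g h), m ∈ RandomRods.rodSpace δ :=
    fun h hh => RandomRods.ae_mem_rodSpace hball hdist hγ' g (le_of_lt hh)
  have hlim : ∀ k₀ : ℝ, 0 < k₀ → _ := fun k₀ hk =>
    RandomRods.summable_limitTerm_and_tendsto_effPermeability (φ := φ) (fun n => (hlam n).le) hmem
      hγ' hg0 hg1 hgi hL hgc hk
  have hterm : ∀ k₀ n, 0 ≤ RandomRods.eigenMean φ n ^ 2 *
      (Real.pi * RandomRods.shiftedDensity γ ρmax g k₀ (lam n) 0) := fun k₀ n =>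
    mul_nonneg (sq_nonneg _) (mul_nonneg Real.pi_pos.le
      (RandomRods.shiftedDensity_nonneg hg0 (hlam n).le k₀ 0))
  refine ⟨fun k₀ hk => ⟨fun h hh n => ?_, fun h hh => ?_, fun n => ?_, (hlim k₀ hk).1,
    (hlim k₀ hk).2, ?_⟩, RandomRods.rodLaw_zero_im_pos θ₀ γ g, ?_⟩
  · exact (RandomRods.integrable_resonantRatio hk hγ' hgi (lam n) θ₀ hh).integrableOn
  · exact RandomRods.summable_permeabilityTerm (fun n => (hlam n).le) hmem hγ' hg0 hg1 hgi hL hgc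
      hk hh
  · have h1 := RandomRods.hasPrincipalValue_div
      (RandomRods.lipschitzWith_shiftedDensity hγ' hL hS k₀ (lam n))
      (RandomRods.integrable_shiftedDensity hγ' hL.continuous.measurable hgi k₀ (lam n))
    rwa [h1.principalValue_eq]
  · exact (RandomRods.hasSum_im_limitPermeability (hlim k₀ hk).1).nonneg (hterm k₀)
  · rintro ⟨a, ha, hga⟩
    -- Otherwise the squared means would sum to `0` instead of `π`. One such mode suffices, all
    -- other contributions being nonnegative.
    obtain ⟨n, hn⟩ : ∃ n, RandomRods.eigenMean φ n ≠ 0 := by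
      by_contra! h0
      have h1 := RandomRods.hasSum_sq_eigenMean φ
      simp only [h0] at h1
      exact Real.pi_ne_zero (h1.unique (by simp))
    obtain ⟨k₁, k₂, h1, h2, h3⟩ := RandomRods.exists_interval_shiftedDensity_zero_pos hγ' hg0
      hL.continuous hS ha hga (hlam n)
    refine ⟨k₁, k₂, h1, h2, fun k₀ hk => ?_⟩
    have h4 := RandomRods.hasSum_im_limitPermeability (hlim k₀ (h1.trans hk.1)).1
    refine lt_of_lt_of_le ?_ (le_hasSum h4 n fun m _ => hterm k₀ m)
    exact mul_pos (by positivity) (mul_pos Real.pi_pos (h3 k₀ hk))
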